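/- Let $m\ge 1$ and let $\mathcal A=\{A_1,\dots,A_n\}$ be a finite family of real $m\times m$ matrices that are simultaneously diagonalized by one invertible, possibly complex, matrix $S$. Let $\operatorname{Cone}\mathcal A$ be the set of all linear combinations of $A_1,\dots,A_n$ with nonnegative coefficients, let $q$ be the maximal number of distinct (complex) eigenvalues of a matrix in $\operatorname{Cone}\mathcal A$, and let $B_0\in\operatorname{Cone}\mathcal A$ be a matrix attaining it. Arrange the columns of $S$ so that $$B_0=S\operatorname{diag}[b_1I_{s_1},\dots,b_qI_{s_q}]S^{-1},\qquad b_i\ne b_j\ \ (i\neq j),\quad s_i\ge 1 .$$ Then there are $\lambda_{ij}\in\mathbb C$ with $$A_j=S\operatorname{diag}[\lambda_{1j}I_{s_1},\dots,\lambda_{qj}I_{s_q}]S^{-1},\qquad j=1,\dots,n .$$ For $e=(e_1,\dots,e_n)\in\mathbb Z_+^n$ put $\mu_i(e)=\lambda_{i1}^{e_1}\cdots\lambda_{in}^{e_n}$ (with $0^0=1$) and $$\Omega(e)=\Big\{i_0\in\{1,\dots,q\}:\ \mu_{i_0}(e)=\max_{1\le i\le q}|\mu_i(e)|\Big\}.$$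 Let $p(e)$ be the index $p\in\Omega(e)$ with $b_p=\max_{i_0\in\Omega(e)}|b_{i_0}|$; there is at most one such index, and if there is none (in particular if $\Omega(e)=\emptyset$), then $p(e)$ is undefined. Let $P$ be the set of all $p(e)$, $e\in\mathbb Z_+^n$. A proper cone is a set $K\subseteq\mathbb R^m$ with $aK\subseteq K$ for all $a\ge0$ and $K+K\subseteq K$ that is closed, pointed ($K\cap(-K)=\{0\}$) and has nonempty interior; a set $K$ is $\mathcal A$-invariant if $A_jK\subseteq K$ for all $j$. **Theorem.** There exists an $\mathcal A$-invariant proper cone if and only if $p(e)$ is defined for every $e\in\mathbb Z_+^n$ and $$\lambda_{ij}\ge 0\quad\text{(that is, real and nonnegative) for all } i\in P \text{ and all } j=1,\dots,n .$$ Moreover, suppose that the latter condition holds. Then $\mathbb R^m$ has a basis $F=F_+\cup F_-\cup F_c$ such that (writing $E_i$ for the complex span of the columns of $S$ in the $i$-th block) every vector of $F_+$ lies in some $E_i$ with $i\in P$, every vector of $F_-$ lies in some $E_i$ with $i\notin P$ and $b_i$ real, and $F_c$ consists of pairs $u,v$ such that $u+\sqrt{-1}\,v$ lies in some $E_i$ with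 $b_i$ non-real. For every such basis, let $f$ be the sum of the vectors of $F_+$ and let $K_0$ be the smallest $\mathcal A$-invariant convex cone containing $F_+$, $f+F_-$ and $f+F_c$. Then $K_0$ is reproducing (it spans $\mathbb R^m$), and its closure is an $\mathcal A$-invariant proper cone. -/

import Mathlib

open scoped Pointwise ComplexOrder Matrix

namespace InvCone

/-- A convex cone in `ℝ^m`: closed under multiplication by scalars `a ≥ 0` and under addition. -/
structure IsConvexCone {m : ℕ} (K : Set (Fin m → ℝ)) : Prop where
  smul_mem : ∀ a : ℝ, 0 ≤ a → ∀ x ∈ K, a • x ∈ K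
  add_mem : ∀ x ∈ K, ∀ y ∈ K, x + y ∈ K

/-- A proper cone: convex, closed, pointed and solid. -/
structure IsProperCone {m : ℕ} (K : Set (Fin m → ℝ)) : Prop extends IsConvexCone K where
  closed : IsClosed K
  pointed : K ∩ -K = {0}
  solid : (interior K).Nonempty

/-- `K` is invariant under every member of the family `A`. -/
def IsInvariant {m n : ℕ} (A : Fin n → Matrix (Fin m) (Fin m) ℝ) (K : Set (Fin m → ℝ)) : Prop :=
  ∀ j, ∀ x ∈ K, A j *ᵥ x ∈ K

/-- The convex cone generated by the family `A` in the space of matrices: all linear combinations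
with nonnegative coefficients. -/
def matrixCone {m n : ℕ} (A : Fin n → Matrix (Fin m) (Fin m) ℝ) :
    Set (Matrix (Fin m) (Fin m) ℝ) :=
  {B | ∃ c : Fin n → ℝ, (∀ j, 0 ≤ c j) ∧ B = ∑ j, c j • A j}

/-- A real matrix regarded as a complex one. -/
def toC {m : ℕ} (B : Matrix (Fin m) (Fin m) ℝ) : Matrix (Fin m) (Fin m) ℂ :=
  B.map (fun x : ℝ => (x : ℂ))

/-- The number of distinct (complex) eigenvalues of a real matrix. -/
noncomputable def numEigenvalues {m : ℕ} (B : Matrix (Fin m) (Fin m) ℝ) : ℕ :=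
  (spectrum ℂ (toC B)).ncard

/-- `S diag[x₁ I, …, x_q I] S⁻¹`, where column `c` of `S` belongs to the block `β c`; thus the size
`s_i` of block `i` is the number of `c` with `β c = i`. -/
noncomputable def blockConj {m q : ℕ} (S : Matrix (Fin m) (Fin m) ℂ) (β : Fin m → Fin q)
    (x : Fin q → ℂ) : Matrix (Fin m) (Fin m) ℂ :=
  S * Matrix.diagonal (fun c => x (β c)) * S⁻¹

/-- The eigenvalue `λ_{i1}^{e_1} ⋯ λ_{in}^{e_n}` of `A_1^{e_1} ⋯ A_n^{e_n}` on block `i`. -/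
noncomputable def prodEig {q n : ℕ} (lam : Fin q → Fin n → ℂ) (e : Fin n → ℕ) (i : Fin q) : ℂ :=
  ∏ j, lam i j ^ e j

/-- `Ω(e)`: the indices `i₀` for which `λ_{i₀1}^{e_1} ⋯ λ_{i₀n}^{e_n}` equals the maximum over `i`
of `|λ_{i1}^{e_1} ⋯ λ_{in}^{e_n}|`. -/
def Omega {q n : ℕ} (lam : Fin q → Fin n → ℂ) (e : Fin n → ℕ) : Set (Fin q) :=
  {i₀ | ((⨆ i, ‖prodEig lam e i‖ : ℝ) : ℂ) = prodEig lam e i₀}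

/-- `p` is an index in `Ω(e)` with `b_p` equal to the maximum of `|b_{i₀}|` over `i₀ ∈ Ω(e)`. -/
def IsDominantIndex {q n : ℕ} (lam : Fin q → Fin n → ℂ) (b : Fin q → ℂ) (e : Fin n → ℕ)
    (p : Fin q) : Prop :=
  p ∈ Omega lam e ∧ ((⨆ i₀ : Omega lam e, ‖b i₀‖ : ℝ) : ℂ) = b p

/-- The set `P` of all the dominant indices `p(e)`, `e ∈ ℤ₊ⁿ`. -/
def dominantSet {q n : ℕ} (lam : Fin q → Fin n → ℂ) (b : Fin q → ℂ) : Set (Fin q) :=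
  {p | ∃ e : Fin n → ℕ, IsDominantIndex lam b e p}

/-- The complex span of the columns of `S` that belong to block `i`. -/
def blockSpan {m q : ℕ} (S : Matrix (Fin m) (Fin m) ℂ) (β : Fin m → Fin q) (i : Fin q) :
    Submodule ℂ (Fin m → ℂ) :=
  Submodule.span ℂ {x | ∃ c, β c = i ∧ x = S.col c}

/-- The vectors `Fp` (playing the role of `F₊`), `Fm` (of `F₋`) and `u`, `v` (together, of `F_c`)
form a basis of `ℝ^m`; every vector of `Fp` is in a block with index in `P`, every vector of `Fm`
is in a block with index outside `P` for which `b_i` is real, and every `u t + √-1 v t` is in a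
block for which `b_i` is not real. -/
structure IsAdaptedBasis {m q : ℕ} (S : Matrix (Fin m) (Fin m) ℂ) (β : Fin m → Fin q)
    (b : Fin q → ℂ) (P : Set (Fin q)) {mp mm mc : ℕ} (Fp : Fin mp → Fin m → ℝ)
    (Fm : Fin mm → Fin m → ℝ) (u v : Fin mc → Fin m → ℝ) : Prop where
  linearIndependent : LinearIndependent ℝ (Sum.elim Fp (Sum.elim Fm (Sum.elim u v)))
  span_eq_top : Submodule.span ℝ (Set.range (Sum.elim Fp (Sum.elim Fm (Sum.elim u v)))) = ⊤
  mem_plus : ∀ t, ∃ i, i ∈ P ∧ (fun r => (Fp t r : ℂ)) ∈ blockSpan S β i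
  mem_minus : ∀ t, ∃ i, i ∉ P ∧ (b i).im = 0 ∧ (fun r => (Fm t r : ℂ)) ∈ blockSpan S β i
  mem_cplx : ∀ t, ∃ i, (b i).im ≠ 0 ∧
    (fun r => (u t r : ℂ) + Complex.I * (v t r : ℂ)) ∈ blockSpan S β i

/-- The smallest `A`-invariant convex cone containing `X`. -/
def smallestInvariantCone {m n : ℕ} (A : Fin n → Matrix (Fin m) (Fin m) ℝ)
    (X : Set (Fin m → ℝ)) : Set (Fin m → ℝ) :=
  ⋂₀ {C | X ⊆ C ∧ IsConvexCone C ∧ IsInvariant A C}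

/-- The set `F₊ ∪ (f + F₋) ∪ (f + F_c)`, where `f` is the sum of the vectors of `F₊`. -/
def generators {m mp mm mc : ℕ} (Fp : Fin mp → Fin m → ℝ) (Fm : Fin mm → Fin m → ℝ)
    (u v : Fin mc → Fin m → ℝ) : Set (Fin m → ℝ) :=
  Set.range Fp ∪ Set.range (fun t => (∑ l, Fp l) + Fm t) ∪
    (Set.range (fun t => (∑ l, Fp l) + u t) ∪ Set.range (fun t => (∑ l, Fp l) + v t))

end InvCone

/-! The family is reduced to its tuples of block eigenvalues: `blockHom` turns algebra in these
tuples into matrix algebra, and maximality of `q` forces every `A j` to be scalar on each block of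
`B₀` (`exists_block_eigenvalues`).

Necessity is a refined Perron theorem (`exists_preserves_projection`). If `M` preserves a proper
cone and has spectral radius `ρ > 0`, the Cesàro means of the powers of `M / ρ` converge to the
spectral projection for the eigenvalue `ρ`. The limit is real and preserves the cone, and
pointedness prevents it from vanishing. Apply this to the product of the `A_j ^ e_j` to get the
projection onto the blocks in `Ω(e)`, then to `B₀` restricted to those blocks. As the `b_i` are
distinct, what remains is the projection onto the single block `p(e)`. Its image contains a nonzero
vector of the cone, a real common eigenvector of all `A j`; pointedness makes the eigenvalues
nonnegative.

For sufficiency, `dominatedCone` is a closed pointed cone in which the sum of the nonnegative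
`F₊`-coordinates bounds all other coordinates. Every product of the `A j` maps every generator into
it: the coefficients on `F₊` are nonnegative, and one of them is the spectral radius, because the
block `p(e)` contains a vector of `F₊` (`IsAdaptedBasis.exists_plus_mem`). Thus `K₀` and its closure
lie in this cone, which gives pointedness; solidity follows from spanning. -/

namespace InvCone

/-! ### Block-diagonalizable matrices and coordinates along the columns of `S` -/

section BlockMatrices

variable {m n q : ℕ}

theorem toC_eq_mapMatrix (B : Matrix (Fin m) (Fin m) ℝ) :
    toC B = Complex.ofRealAm.mapMatrix B := rfl

theorem toC_injective : Function.Injective (toC : Matrix (Fin m) (Fin m) ℝ → _) := by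
  intro A B h
  ext i j
  have := congrFun (congrFun h i) j
  simpa [toC] using this

theorem toC_mulVec (B : Matrix (Fin m) (Fin m) ℝ) (x : Fin m → ℝ) :
    toC B *ᵥ (fun r => (x r : ℂ)) = fun r => ((B *ᵥ x) r : ℂ) := by
  ext r
  simp [toC, Matrix.mulVec, dotProduct]

/-- `blockConj` as an algebra homomorphism on the tuples of block eigenvalues. -/
noncomputable def blockHom {S : Matrix (Fin m) (Fin m) ℂ} (hS : IsUnit S) (β : Fin m → Fin q) :
    (Fin q → ℂ) →ₐ[ℂ] Matrix (Fin m) (Fin m) ℂ :=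
  have hdet := (Matrix.isUnit_iff_isUnit_det S).1 hS
  AlgHom.ofLinearMap
    { toFun := blockConj S β
      map_add' := fun x y => by
        rw [blockConj, blockConj, blockConj, ← add_mul, ← mul_add, Matrix.diagonal_add]; rfl
      map_smul' := fun a x => by
        rw [RingHom.id_apply, blockConj, blockConj, ← smul_mul_assoc, ← mul_smul_comm,
          ← Matrix.diagonal_smul]; rfl }
    (by
      change S * Matrix.diagonal (fun _ => 1) * S⁻¹ = 1
      rw [Matrix.diagonal_one, mul_one, Matrix.mul_nonsing_inv S hdet])
    (fun x y => by
      change blockConj S β (x * y) = blockConj S β x * blockConj S β y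
      simp only [blockConj, mul_assoc]
      rw [← mul_assoc S⁻¹, Matrix.nonsing_inv_mul S hdet, one_mul, ← mul_assoc (Matrix.diagonal _),
        Matrix.diagonal_mul_diagonal]
      rfl)

theorem blockHom_apply {S : Matrix (Fin m) (Fin m) ℂ} (hS : IsUnit S) (β : Fin m → Fin q)
    (x : Fin q → ℂ) : blockHom hS β x = blockConj S β x := rfl

theorem continuous_blockConj (S : Matrix (Fin m) (Fin m) ℂ) (β : Fin m → Fin q) :
    Continuous (blockConj S β) := by
  unfold blockConj
  fun_prop

/-- The coordinates with respect to the columns of `S`. -/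
noncomputable def coord (S : Matrix (Fin m) (Fin m) ℂ) (c : Fin m) : (Fin m → ℂ) →ₗ[ℂ] ℂ :=
  LinearMap.proj c ∘ₗ Matrix.mulVecLin S⁻¹

theorem coord_apply (S : Matrix (Fin m) (Fin m) ℂ) (c : Fin m) (x : Fin m → ℂ) :
    coord S c x = (S⁻¹ *ᵥ x) c := rfl

variable {S : Matrix (Fin m) (Fin m) ℂ}

theorem sum_coord_smul_col (hS : IsUnit S) (x : Fin m → ℂ) :
    ∑ c, coord S c x • S.col c = x := by
  have hdet := (Matrix.isUnit_iff_isUnit_det S).1 hS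
  have : S *ᵥ (S⁻¹ *ᵥ x) = x := by
    rw [Matrix.mulVec_mulVec, Matrix.mul_nonsing_inv S hdet, Matrix.one_mulVec]
  conv_rhs => rw [← this]
  ext r
  simp [Matrix.mulVec, dotProduct, coord_apply, mul_comm, Finset.sum_apply]

theorem eq_zero_of_coord_eq_zero (hS : IsUnit S) {x : Fin m → ℂ} (h : ∀ c, coord S c x = 0) :
    x = 0 := by
  rw [← sum_coord_smul_col hS x]
  simp [h]

theorem coord_col (hS : IsUnit S) (c d : Fin m) :
    coord S c (S.col d) = if c = d then 1 else 0 := by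
  have hdet := (Matrix.isUnit_iff_isUnit_det S).1 hS
  have : (S⁻¹ * S) c d = if c = d then 1 else 0 := by
    rw [Matrix.nonsing_inv_mul S hdet, Matrix.one_apply]
  rw [← this]; rfl

theorem coord_blockConj_mulVec (hS : IsUnit S) (β : Fin m → Fin q) (x : Fin q → ℂ) (c : Fin m)
    (y : Fin m → ℂ) : coord S c (blockConj S β x *ᵥ y) = x (β c) * coord S c y := by
  have hdet := (Matrix.isUnit_iff_isUnit_det S).1 hS
  rw [coord_apply, blockConj, Matrix.mulVec_mulVec, ← mul_assoc, ← mul_assoc,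
    Matrix.nonsing_inv_mul S hdet, one_mul, ← Matrix.mulVec_mulVec, Matrix.mulVec_diagonal,
    coord_apply]

theorem blockConj_injective (hS : IsUnit S) {β : Fin m → Fin q} (hβ : Function.Surjective β) :
    Function.Injective (blockConj S β) := by
  intro x y h
  funext i
  obtain ⟨c, rfl⟩ := hβ i
  have := coord_blockConj_mulVec hS β x c (S.col c)
  rw [h, coord_blockConj_mulVec hS, coord_col hS] at this
  simpa using this.symm

/-- Real vectors span `ℂ^m` over `ℂ`, so no nonzero complex functional vanishes on all of them. -/
theorem exists_coord_ofReal_ne_zero (hS : IsUnit S) (c : Fin m) :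
    ∃ x : Fin m → ℝ, coord S c (fun r => (x r : ℂ)) ≠ 0 := by
  by_contra! h
  have h1 := coord_col hS c c
  have h2 : S.col c = (fun r => (((S.col c r).re : ℝ) : ℂ)) +
      Complex.I • (fun r => (((S.col c r).im : ℝ) : ℂ)) := by
    ext r
    simp [mul_comm Complex.I]
  rw [h2, map_add, map_smul, h, h] at h1
  simp at h1

/-- The coordinates of real vectors with respect to the columns of `S`. -/
noncomputable def realCoord (S : Matrix (Fin m) (Fin m) ℂ) (c : Fin m) : (Fin m → ℝ) →ₗ[ℝ] ℂ :=
  (coord S c).restrictScalars ℝ ∘ₗ Complex.ofRealAm.toLinearMap.compLeft (Fin m)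

theorem realCoord_apply (S : Matrix (Fin m) (Fin m) ℂ) (c : Fin m) (x : Fin m → ℝ) :
    realCoord S c x = coord S c (fun r => (x r : ℂ)) := rfl

theorem realCoord_ne_zero (hS : IsUnit S) (c : Fin m) : realCoord S c ≠ 0 := by
  obtain ⟨x, hx⟩ := exists_coord_ofReal_ne_zero hS c
  rintro h
  apply hx
  rw [← realCoord_apply, h, LinearMap.zero_apply]

theorem mem_blockSpan_iff (hS : IsUnit S) (β : Fin m → Fin q) (i : Fin q) (x : Fin m → ℂ) :
    x ∈ blockSpan S β i ↔ ∀ c, β c ≠ i → coord S c x = 0 := by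
  constructor
  · intro h c hc
    have : blockSpan S β i ≤ LinearMap.ker (coord S c) := by
      rw [blockSpan, Submodule.span_le]
      rintro _ ⟨d, hd, rfl⟩
      rw [SetLike.mem_coe, LinearMap.mem_ker, coord_col hS, if_neg]
      rintro rfl
      exact hc hd
    exact this h
  · intro h
    rw [← sum_coord_smul_col hS x]
    refine Submodule.sum_mem _ fun c _ => ?_
    by_cases hc : β c = i
    · exact Submodule.smul_mem _ _ (Submodule.subset_span ⟨c, hc, rfl⟩)
    · simp [h c hc]

theorem blockConj_mulVec_of_mem (hS : IsUnit S) {β : Fin m → Fin q} {i : Fin q} {x : Fin m → ℂ}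
    (hx : x ∈ blockSpan S β i) (y : Fin q → ℂ) : blockConj S β y *ᵥ x = y i • x := by
  rw [← sub_eq_zero]
  refine eq_zero_of_coord_eq_zero hS fun c => ?_
  rw [map_sub, map_smul, coord_blockConj_mulVec hS, smul_eq_mul]
  by_cases hc : β c = i
  · rw [hc, sub_self]
  · rw [(mem_blockSpan_iff hS β i x).1 hx c hc]; simp

/-- If `x` lies in the block with eigenvalue `b i` of a real matrix, then the coordinates of the
conjugate of `x` vanish outside of the block with the conjugate eigenvalue. -/
theorem coord_star_eq_zero (hS : IsUnit S) {β : Fin m → Fin q} {b : Fin q → ℂ}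
    {B : Matrix (Fin m) (Fin m) ℝ} (hB : toC B = blockConj S β b) {i : Fin q} {x : Fin m → ℂ}
    (hx : x ∈ blockSpan S β i) {c : Fin m} (hc : b (β c) ≠ star (b i)) :
    coord S c (star x) = 0 := by
  have h1 := blockConj_mulVec_of_mem hS hx b
  rw [← hB] at h1
  -- `B` is real, so conjugating the eigenvector equation conjugates only the eigenvalue and the
  -- vector.
  have h2 : toC B *ᵥ star x = star (b i) • star x := by
    rw [← star_smul, ← h1]
    ext r
    simp [toC, Matrix.mulVec, dotProduct]
  have h3 := congrArg (coord S c) h2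
  rw [hB, coord_blockConj_mulVec hS, map_smul, smul_eq_mul, ← sub_eq_zero, ← sub_mul] at h3
  exact (mul_eq_zero.1 h3).resolve_left (sub_ne_zero.2 hc)

theorem mulVec_eq_of_mem_blockSpan (hS : IsUnit S) {β : Fin m → Fin q}
    {M : Matrix (Fin m) (Fin m) ℝ} {μ : Fin q → ℂ} (hM : toC M = blockConj S β μ) {i : Fin q}
    {u v : Fin m → ℝ} (h : (fun r => (u r : ℂ) + Complex.I * (v r : ℂ)) ∈ blockSpan S β i) :
    M *ᵥ u = (μ i).re • u - (μ i).im • v ∧ M *ᵥ v = (μ i).im • u + (μ i).re • v := by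
  have h1 := blockConj_mulVec_of_mem hS h μ
  have h2 : (fun r => (u r : ℂ) + Complex.I * (v r : ℂ)) =
      (fun r => (u r : ℂ)) + Complex.I • fun r => (v r : ℂ) := rfl
  rw [← hM, h2, Matrix.mulVec_add, Matrix.mulVec_smul, toC_mulVec, toC_mulVec] at h1
  constructor
  · ext r
    simpa using congrArg Complex.re (congrFun h1 r)
  · ext r
    simpa [add_comm] using congrArg Complex.im (congrFun h1 r)

theorem mulVec_eq_of_ofReal_mem_blockSpan (hS : IsUnit S) {β : Fin m → Fin q}
    {M : Matrix (Fin m) (Fin m) ℝ} {μ : Fin q → ℂ} (hM : toC M = blockConj S β μ) {i : Fin q}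
    {y : Fin m → ℝ} (h : (fun r => (y r : ℂ)) ∈ blockSpan S β i) :
    M *ᵥ y = (μ i).re • y := by
  have := (mulVec_eq_of_mem_blockSpan hS hM (u := y) (v := 0) (by simpa using h)).1
  simpa using this

end BlockMatrices

/-! ### Maximality of `q` and the block eigenvalues -/

section Eigenvalues

variable {m n q : ℕ} {S : Matrix (Fin m) (Fin m) ℂ}

theorem numEigenvalues_eq (hS : IsUnit S) {B : Matrix (Fin m) (Fin m) ℝ} {d : Fin m → ℂ}
    (h : toC B = S * Matrix.diagonal d * S⁻¹) : numEigenvalues B = (Set.range d).ncard := by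
  obtain ⟨u, rfl⟩ := hS
  rw [numEigenvalues, h, ← Matrix.coe_units_inv, spectrum.units_conjugate, spectrum_diagonal]

/-- Affine functions `t ↦ b k + t * d k` that are pairwise distinct take pairwise distinct values
at some positive `t`. -/
theorem exists_pos_injective_add_mul {ι : Type*} [Finite ι] (b d : ι → ℂ)
    (h : ∀ k l, b k = b l → d k = d l → k = l) :
    ∃ t : ℝ, 0 < t ∧ Function.Injective fun k => b k + t * d k := by
  -- Two distinct affine functions agree at no more than one `t`, so only finitely many `t` are bad.
  have hfin : (⋃ k : ι × ι, {t : ℝ | k.1 ≠ k.2 ∧ b k.1 + t * d k.1 = b k.2 + t * d k.2}).Finite := by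
    refine Set.finite_iUnion fun k => Set.Subsingleton.finite ?_
    rintro t ⟨hk, ht⟩ s ⟨-, hs⟩
    have h1 : ((t : ℂ) - s) * (d k.1 - d k.2) = 0 := by linear_combination ht - hs
    rcases mul_eq_zero.1 h1 with h1 | h1
    · exact_mod_cast sub_eq_zero.1 h1
    · have h2 := sub_eq_zero.1 h1
      rw [h2] at ht
      exact absurd (h _ _ (add_right_cancel ht) h2) hk
  obtain ⟨t, ht, ht'⟩ := (Set.Ioi_infinite (0 : ℝ)).exists_notMem_finite hfin
  refine ⟨t, ht, fun k l hkl => ?_⟩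
  by_contra hne
  exact ht' (Set.mem_iUnion.2 ⟨(k, l), hne, hkl⟩)

/-- If `A j` had two different eigenvalues on one block of `B₀`, then for a suitable `t > 0` the
matrix `B₀ + t • A j`, still in the cone, would separate them while keeping the blocks apart, giving
at least `q + 1` eigenvalues. -/
theorem exists_block_eigenvalues {A : Fin n → Matrix (Fin m) (Fin m) ℝ} (hS : IsUnit S)
    (hdiag : ∀ j, ∃ d : Fin m → ℂ, toC (A j) = S * Matrix.diagonal d * S⁻¹)
    (hq : ∀ B ∈ matrixCone A, numEigenvalues B ≤ q)
    {B₀ : Matrix (Fin m) (Fin m) ℝ} (hB₀ : B₀ ∈ matrixCone A)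
    {β : Fin m → Fin q} (hβ : Function.Surjective β)
    {b : Fin q → ℂ} (hb : Function.Injective b) (hB₀S : toC B₀ = blockConj S β b) :
    ∃ lam : Fin q → Fin n → ℂ, ∀ j, toC (A j) = blockConj S β (fun i => lam i j) := by
  choose d hd using hdiag
  suffices H : ∀ j c c', β c = β c' → d j c = d j c' by
    refine ⟨fun i j => d j (Function.surjInv hβ i), fun j => ?_⟩
    rw [hd j, blockConj]
    congr 3
    funext c
    exact H j _ _ (Function.surjInv_eq hβ _).symm
  intro j c c' hcc
  by_contra hne
  -- `g` selects `q + 1` columns: one from each block, with `c` representing its own block, and the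
  -- extra column `c'` at `none`. The pairs of eigenvalues of `B₀` and `A j` on them are pairwise
  -- distinct.
  have key : ∀ k l : Option (Fin q), ∀ g : Option (Fin q) → Fin m,
      g = (fun k => k.elim c' (fun i => if i = β c then c else Function.surjInv hβ i)) →
      b (β (g k)) = b (β (g l)) → d j (g k) = d j (g l) → k = l := by
    rintro k l g rfl h1 h2
    have hβg : ∀ i, β (if i = β c then c else Function.surjInv hβ i) = i := by
      intro i
      split_ifs with hi
      · exact hi.symm
      · exact Function.surjInv_eq hβ i
    have h1' := hb h1
    rcases k with _ | k <;> rcases l with _ | l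
    · rfl
    · simp only [Option.elim] at h1' h2
      rw [hβg, ← hcc] at h1'
      rw [if_pos h1'.symm] at h2
      exact absurd h2.symm hne
    · simp only [Option.elim] at h1' h2
      rw [hβg, ← hcc] at h1'
      rw [if_pos h1'] at h2
      exact absurd h2 hne
    · simp only [Option.elim] at h1'
      rw [hβg, hβg] at h1'
      rw [h1']
  obtain ⟨g, hg⟩ : ∃ g : Option (Fin q) → Fin m,
      ∀ k l, b (β (g k)) = b (β (g l)) → d j (g k) = d j (g l) → k = l :=
    ⟨_, fun k l => key k l _ rfl⟩
  obtain ⟨t, ht, hinj⟩ := exists_pos_injective_add_mul (fun k => b (β (g k))) (fun k => d j (g k)) hg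
  have hmem : B₀ + t • A j ∈ matrixCone A := by
    obtain ⟨a, ha, rfl⟩ := hB₀
    refine ⟨a + Pi.single j t, fun k => add_nonneg (ha k) ?_, ?_⟩
    · by_cases hk : k = j
      · subst hk; simpa using ht.le
      · simp [hk]
    · simp [add_smul, Finset.sum_add_distrib, Pi.single_apply, ite_smul]
  have hC : toC (B₀ + t • A j) =
      S * Matrix.diagonal (fun c => b (β c) + t * d j c) * S⁻¹ := by
    have h1 : toC (B₀ + t • A j) = toC B₀ + (t : ℂ) • toC (A j) := by
      ext r s; simp [toC]
    rw [h1, hB₀S, hd j, blockConj, ← smul_mul_assoc, ← mul_smul_comm, ← add_mul, ← mul_add,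
      ← Matrix.diagonal_smul, Matrix.diagonal_add]
    rfl
  have h1 := hq _ hmem
  rw [numEigenvalues_eq hS hC] at h1
  have h2 : (Set.range fun k => b (β (g k)) + t * d j (g k)).ncard = q + 1 := by
    rw [← Set.image_univ, Set.ncard_image_of_injective _ hinj, Set.ncard_univ]
    simp
  have h3 := Set.ncard_le_ncard (t := Set.range fun c => b (β c) + t * d j c)
    (s := Set.range fun k => b (β (g k)) + t * d j (g k))
    (by rintro _ ⟨k, rfl⟩; exact ⟨g k, rfl⟩) (Set.finite_range _)
  omega

end Eigenvalues

/-! ### Proper cones and the matrices preserving them -/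

section Cones

variable {m n q : ℕ} {K : Set (Fin m → ℝ)}

theorem IsProperCone.zero_mem (hK : IsProperCone K) : (0 : Fin m → ℝ) ∈ K := by
  have : (0 : Fin m → ℝ) ∈ K ∩ -K := by rw [hK.pointed]; rfl
  exact this.1

theorem IsProperCone.eq_zero_of_neg_mem (hK : IsProperCone K) {x : Fin m → ℝ} (hx : x ∈ K)
    (hx' : -x ∈ K) : x = 0 := by
  have : x ∈ K ∩ -K := ⟨hx, hx'⟩
  rwa [hK.pointed] at this

theorem IsConvexCone.convex (hK : IsConvexCone K) : Convex ℝ K := fun x hx y hy a c ha hc _ =>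
  hK.add_mem _ (hK.smul_mem a ha x hx) _ (hK.smul_mem c hc y hy)

theorem IsConvexCone.sum_mem (hK : IsConvexCone K) (h0 : (0 : Fin m → ℝ) ∈ K) {ι : Type*}
    (s : Finset ι) {x : ι → Fin m → ℝ} (h : ∀ i ∈ s, x i ∈ K) : ∑ i ∈ s, x i ∈ K := by
  classical
  induction s using Finset.induction_on with
  | empty => simpa using h0
  | insert i s hi ih =>
    rw [Finset.sum_insert hi]
    exact hK.add_mem _ (h _ (Finset.mem_insert_self i s)) _
      (ih fun k hk => h _ (Finset.mem_insert_of_mem hk))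

/-- A closed pointed cone lies in an open half-space, up to its vertex. -/
theorem IsProperCone.exists_norm_le (hK : IsProperCone K) :
    ∃ f : (Fin m → ℝ) →L[ℝ] ℝ, ∀ x ∈ K, ‖x‖ ≤ f x := by
  have hpt : ∀ x ∈ K, x ≠ 0 → ∃ f : (Fin m → ℝ) →L[ℝ] ℝ, (∀ y ∈ K, 0 ≤ f y) ∧ 1 < f x := by
    intro x hx hx0
    have hnx : -x ∉ K := fun h => hx0 (hK.eq_zero_of_neg_mem hx h)
    obtain ⟨f, u, hfx, hf⟩ :=
      geometric_hahn_banach_point_closed hK.toIsConvexCone.convex hK.closed hnx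
    have hu : u < 0 := by simpa using hf 0 hK.zero_mem
    have hfx' : 0 < f x := by
      rw [map_neg] at hfx
      linarith
    -- A negative value could be rescaled to equal `u`, contradicting the strict separation.
    have hnn : ∀ y ∈ K, 0 ≤ f y := by
      intro y hy
      by_contra! hlt
      have := hf _ (hK.smul_mem (u / f y) (div_nonneg_of_nonpos hu.le hlt.le) y hy)
      rw [map_smul, smul_eq_mul, div_mul_cancel₀ _ hlt.ne] at this
      exact lt_irrefl _ this
    refine ⟨(2 / f x) • f, fun y hy => ?_, ?_⟩
    · exact mul_nonneg (div_nonneg zero_le_two hfx'.le) (hnn y hy)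
    · change 1 < 2 / f x * f x
      rw [div_mul_cancel₀ _ hfx'.ne']
      norm_num
  have hcomp : IsCompact (K ∩ Metric.sphere 0 1) := (isCompact_sphere _ _).inter_left hK.closed
  obtain ⟨f, hf0, hf1⟩ : ∃ f : (Fin m → ℝ) →L[ℝ] ℝ,
      (∀ y ∈ K, 0 ≤ f y) ∧ ∀ y ∈ K ∩ Metric.sphere 0 1, 1 ≤ f y := by
    -- Compactness: locally one functional exceeds 1, and the sum of finitely many functionals
    -- nonnegative on `K` works on the whole unit section of `K`.
    refine hcomp.induction_on (p := fun s => ∃ f : (Fin m → ℝ) →L[ℝ] ℝ,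
      (∀ y ∈ K, 0 ≤ f y) ∧ ∀ y ∈ K ∩ s, 1 ≤ f y) ⟨0, by simp, by simp⟩ ?_ ?_ ?_ |>.imp ?_
    · rintro s t hst ⟨f, h0, h1⟩
      exact ⟨f, h0, fun y hy => h1 y ⟨hy.1, hst hy.2⟩⟩
    · rintro s t ⟨f, h0, h1⟩ ⟨g, k0, k1⟩
      refine ⟨f + g, fun y hy => add_nonneg (h0 y hy) (k0 y hy), ?_⟩
      rintro y ⟨hy, hs | ht⟩
      · exact le_add_of_le_of_nonneg (h1 y ⟨hy, hs⟩) (k0 y hy)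
      · exact le_add_of_nonneg_of_le (h0 y hy) (k1 y ⟨hy, ht⟩)
    · rintro x ⟨hx, hx1⟩
      obtain ⟨f, h0, h1⟩ := hpt x hx (by rintro rfl; simp at hx1)
      exact ⟨{y | 1 < f y}, mem_nhdsWithin_of_mem_nhds
        ((isOpen_lt continuous_const f.continuous).mem_nhds h1), f, h0, fun y hy => le_of_lt hy.2⟩
    · rintro f ⟨h0, h1⟩
      exact ⟨h0, fun y hy => h1 y ⟨hy.1, hy⟩⟩
  refine ⟨f, fun x hx => ?_⟩
  rcases eq_or_ne x 0 with rfl | hx0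
  · simp
  have hn : 0 < ‖x‖ := norm_pos_iff.2 hx0
  have := hf1 (‖x‖⁻¹ • x) ⟨hK.smul_mem _ (inv_nonneg.2 hn.le) x hx, by
    rw [mem_sphere_zero_iff_norm, norm_smul, norm_inv, norm_norm, inv_mul_cancel₀ hn.ne']⟩
  rw [map_smul, smul_eq_mul, inv_mul_eq_div, le_div_iff₀ hn, one_mul] at this
  exact this

/-- A kernel containing a solid cone has interior, hence is the whole space. -/
theorem IsProperCone.exists_linearMap_ne_zero (hK : IsProperCone K) {F : Type*} [AddCommGroup F]
    [Module ℝ F] (g : (Fin m → ℝ) →ₗ[ℝ] F) (hg : g ≠ 0) : ∃ x ∈ K, g x ≠ 0 := by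
  by_contra! h
  apply hg
  obtain ⟨x₀, hx₀⟩ := hK.solid
  have : LinearMap.ker g = ⊤ :=
    Submodule.eq_top_of_nonempty_interior' _ ⟨x₀, interior_mono (fun x hx => h x hx) hx₀⟩
  exact LinearMap.ker_eq_top.1 this

/-- The matrix `M` leaves `K` invariant. -/
def Preserves (M : Matrix (Fin m) (Fin m) ℝ) (K : Set (Fin m → ℝ)) : Prop :=
  ∀ x ∈ K, M *ᵥ x ∈ K

theorem preserves_one : Preserves 1 K := fun x hx => by rwa [Matrix.one_mulVec]

theorem Preserves.mul {M N : Matrix (Fin m) (Fin m) ℝ} (hM : Preserves M K)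
    (hN : Preserves N K) : Preserves (M * N) K := fun x hx => by
  rw [← Matrix.mulVec_mulVec]
  exact hM _ (hN _ hx)

theorem Preserves.pow {M : Matrix (Fin m) (Fin m) ℝ} (hM : Preserves M K) (k : ℕ) :
    Preserves (M ^ k) K := by
  induction k with
  | zero => rw [pow_zero]; exact preserves_one
  | succ k ih => rw [pow_succ]; exact ih.mul hM

theorem Preserves.smul (hK : IsConvexCone K) {M : Matrix (Fin m) (Fin m) ℝ}
    (hM : Preserves M K) {a : ℝ} (ha : 0 ≤ a) : Preserves (a • M) K := fun x hx => by
  rw [Matrix.smul_mulVec]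
  exact hK.smul_mem a ha _ (hM x hx)

theorem Preserves.sum (hK : IsConvexCone K) (h0 : (0 : Fin m → ℝ) ∈ K) {ι : Type*}
    (s : Finset ι) {M : ι → Matrix (Fin m) (Fin m) ℝ} (hM : ∀ i ∈ s, Preserves (M i) K) :
    Preserves (∑ i ∈ s, M i) K := fun x hx => by
  rw [Matrix.sum_mulVec]
  exact hK.sum_mem h0 s fun i hi => hM i hi x hx

theorem Preserves.of_tendsto (hK : IsClosed K) {R : ℕ → Matrix (Fin m) (Fin m) ℝ}
    {Q : Matrix (Fin m) (Fin m) ℝ} (hR : ∀ N, Preserves (R N) K)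
    (h : Filter.Tendsto R Filter.atTop (nhds Q)) : Preserves Q K := fun x hx =>
  hK.mem_of_tendsto (((continuous_id.matrix_mulVec continuous_const).tendsto Q).comp h)
    (Filter.Eventually.of_forall fun N => hR N x hx)

end Cones

/-! ### Cesàro means and a Perron theorem for spectral projections -/

section Perron

open Filter

/-- For `z ≠ 1` the geometric sums stay bounded by `2 / ‖z - 1‖`, so averaging kills every
eigenvalue in the closed unit disc except 1. -/
theorem tendsto_average_pow {z : ℂ} (hz : ‖z‖ ≤ 1) :
    Tendsto (fun N : ℕ => (N : ℂ)⁻¹ * ∑ k ∈ Finset.range N, z ^ k) atTop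
      (nhds (if z = 1 then 1 else 0)) := by
  split_ifs with h
  · subst h
    refine tendsto_const_nhds.congr' ?_
    filter_upwards [eventually_gt_atTop 0] with N hN
    have : (N : ℂ) ≠ 0 := by exact_mod_cast hN.ne'
    simp [this]
  · have hpos : 0 < ‖z - 1‖ := norm_pos_iff.2 (sub_ne_zero.2 h)
    have h0 : Tendsto (fun N : ℕ => (N : ℝ)⁻¹ * (2 / ‖z - 1‖)) atTop (nhds 0) := by
      simpa using (tendsto_inv_atTop_nhds_zero_nat (𝕜 := ℝ)).mul_const (2 / ‖z - 1‖)
    refine squeeze_zero_norm (fun N => ?_) h0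
    rw [geom_sum_eq h, norm_mul, norm_inv, Complex.norm_natCast, norm_div]
    gcongr
    calc ‖z ^ N - 1‖ ≤ ‖z ^ N‖ + ‖(1 : ℂ)‖ := norm_sub_le _ _
      _ ≤ 1 + 1 := by
        rw [norm_pow, norm_one]
        gcongr
        exact pow_le_one₀ (norm_nonneg z) hz
      _ = 2 := by norm_num

variable {m n q : ℕ} {K : Set (Fin m → ℝ)} {S : Matrix (Fin m) (Fin m) ℂ}

open Classical in
/-- A Perron theorem with spectral projections: if the spectral projection on the blocks in `I` and
the matrix `M` with block eigenvalues `μ` preserve a proper cone, then the spectral radius `ρ` of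
`M` on these blocks is an eigenvalue there, and the corresponding spectral projection is real and
preserves the cone. -/
theorem exists_preserves_projection (hK : IsProperCone K) (hS : IsUnit S) {β : Fin m → Fin q}
    (hβ : Function.Surjective β) {I : Set (Fin q)} {R M : Matrix (Fin m) (Fin m) ℝ}
    (hR : toC R = blockConj S β (fun i => if i ∈ I then 1 else 0)) (hRK : Preserves R K)
    {μ : Fin q → ℂ} (hM : toC M = blockConj S β μ) (hMK : Preserves M K) {ρ : ℝ}
    (hρ : ∀ i ∈ I, ‖μ i‖ ≤ ρ) (hρ' : ∃ i ∈ I, ‖μ i‖ = ρ) :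
    (∃ i ∈ I, μ i = ρ) ∧ ∃ Q : Matrix (Fin m) (Fin m) ℝ,
      toC Q = blockConj S β (fun i => if i ∈ I ∧ μ i = ρ then 1 else 0) ∧ Preserves Q K := by
  obtain ⟨i₁, hi₁, hi₁ρ⟩ := hρ'
  have hρ0 : 0 ≤ ρ := hi₁ρ ▸ norm_nonneg _
  -- When `ρ = 0` no rescaling is possible, but all `μ i` with `i ∈ I` vanish and `R` itself is the
  -- projection.
  rcases hρ0.eq_or_lt with rfl | hpos
  · refine ⟨⟨i₁, hi₁, by simpa using hi₁ρ⟩, R, ?_, hRK⟩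
    rw [hR]
    congr 1
    funext i
    by_cases hi : i ∈ I
    · simp [hi, norm_le_zero_iff.1 (hρ i hi)]
    · simp [hi]
  have hρC : (ρ : ℂ) ≠ 0 := by exact_mod_cast hpos.ne'
  set T : ℕ → Matrix (Fin m) (Fin m) ℝ := fun k => (ρ⁻¹ • M) ^ k * R with hT
  have hTK : ∀ k, Preserves (T k) K := fun k =>
    ((hMK.smul hK.toIsConvexCone (inv_nonneg.2 hρ0)).pow k).mul hRK
  have hTC : ∀ k, toC (T k) =
      blockConj S β (fun i => if i ∈ I then (μ i / ρ) ^ k else 0) := by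
    intro k
    simp only [hT, toC_eq_mapMatrix, map_mul, map_pow, map_smul]
    rw [← toC_eq_mapMatrix, ← toC_eq_mapMatrix, hM, hR, ← blockHom_apply hS, ← blockHom_apply hS,
      ← blockHom_apply hS, ← algebraMap_smul ℂ ρ⁻¹, ← map_smul, ← map_pow, ← map_mul]
    congr 1
    funext i
    simp [div_eq_inv_mul]
  set V : ℕ → Matrix (Fin m) (Fin m) ℝ :=
    fun N => (N : ℝ)⁻¹ • ∑ k ∈ Finset.range N, T k with hV
  have hVK : ∀ N, Preserves (V N) K := fun N =>
    (Preserves.sum hK.toIsConvexCone hK.zero_mem _ fun k _ => hTK k).smul hK.toIsConvexCone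
      (by positivity)
  have hVC : ∀ N : ℕ, toC (V N) = blockConj S β
      (fun i => if i ∈ I then (N : ℂ)⁻¹ * ∑ k ∈ Finset.range N, (μ i / ρ) ^ k else 0) := by
    intro N
    simp only [hV, toC_eq_mapMatrix, map_sum, map_smul]
    simp only [← toC_eq_mapMatrix, hTC, ← blockHom_apply hS]
    rw [← algebraMap_smul ℂ (N : ℝ)⁻¹, ← map_sum, ← map_smul]
    congr 1
    funext i
    by_cases hi : i ∈ I <;> simp [hi]
  have hlim : Tendsto (fun N => toC (V N)) atTop
      (nhds (blockConj S β (fun i => if i ∈ I ∧ μ i = ρ then 1 else 0))) := by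
    simp only [hVC]
    refine ((continuous_blockConj S β).tendsto _).comp (tendsto_pi_nhds.2 fun i => ?_)
    by_cases hi : i ∈ I
    · have hz : ‖μ i / ρ‖ ≤ 1 := by
        rw [norm_div, Complex.norm_real, Real.norm_of_nonneg hρ0]
        exact div_le_one_of_le₀ (hρ i hi) hρ0
      simpa [hi, div_eq_one_iff_eq hρC] using tendsto_average_pow hz
    · simp [hi]
  -- The `V N` are real, so the entrywise real part of the complex limit is their limit.
  obtain ⟨Q, hQ⟩ : ∃ Q : Matrix (Fin m) (Fin m) ℝ, Tendsto V atTop (nhds Q) := by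
    refine ⟨_, (((continuous_id.matrix_map Complex.continuous_re).tendsto _).comp hlim).congr
      fun N => ?_⟩
    ext r s
    simp [toC]
  have hQC : toC Q = blockConj S β (fun i => if i ∈ I ∧ μ i = ρ then 1 else 0) :=
    tendsto_nhds_unique
      (((continuous_id.matrix_map Complex.continuous_ofReal).tendsto Q).comp hQ) hlim
  refine ⟨?_, Q, hQC, Preserves.of_tendsto hK.closed hVK hQ⟩
  by_contra! hno
  have hQ0 : Q = 0 := by
    apply toC_injective
    rw [hQC, toC_eq_mapMatrix, map_zero, ← blockHom_apply hS, ← map_zero (blockHom hS β)]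
    congr 1
    funext i
    simp only [Pi.zero_apply, ite_eq_right_iff, one_ne_zero]
    exact fun h => hno i h.1 h.2
  obtain ⟨f, hf⟩ := hK.exists_norm_le
  obtain ⟨c, rfl⟩ := hβ i₁
  -- Along a column whose eigenvalue has modulus `ρ`, the rescaled powers keep `‖g x‖` constant.
  -- Since `f` dominates the norm on `K`, this bounds `f (T k *ᵥ x)` below; being linear in `f`, the
  -- bound passes to the averages, which contradicts `V N → 0`.
  set g := realCoord S c with hg
  obtain ⟨x, hx, hgx⟩ := hK.exists_linearMap_ne_zero g (realCoord_ne_zero hS c)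
  have hgT : ∀ k, ‖g (T k *ᵥ x)‖ = ‖g x‖ := by
    intro k
    rw [hg, realCoord_apply, ← toC_mulVec, hTC, coord_blockConj_mulVec hS, if_pos hi₁, norm_mul, norm_pow, norm_div,
      hi₁ρ, Complex.norm_real, Real.norm_of_nonneg hρ0, div_self hpos.ne', one_pow, one_mul,
      realCoord_apply]
  obtain ⟨C, hC0, hC⟩ : ∃ C > 0, ∀ y, ‖g y‖ ≤ C * ‖y‖ :=
    (LinearMap.toContinuousLinearMap g).bound
  have hlow : ∀ k, ‖g x‖ / C ≤ f (T k *ᵥ x) := fun k => by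
    refine le_trans ?_ (hf _ (hTK k x hx))
    rw [div_le_iff₀' hC0, ← hgT k]
    exact hC _
  have hlow' : ∀ N : ℕ, 0 < N → ‖g x‖ / C ≤ f (V N *ᵥ x) := by
    intro N hN
    have hN' : (0 : ℝ) < N := by exact_mod_cast hN
    simp only [hV, Matrix.smul_mulVec, Matrix.sum_mulVec, map_smul, map_sum, smul_eq_mul]
    rw [inv_mul_eq_div, le_div_iff₀ hN', mul_comm, ← nsmul_eq_mul]
    simpa using Finset.card_nsmul_le_sum (Finset.range N) (fun k => f (T k *ᵥ x)) _
      fun k _ => hlow k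
  have hlim0 : Tendsto (fun N => f (V N *ᵥ x)) atTop (nhds 0) := by
    have h1 := ((f.continuous.comp (continuous_id.matrix_mulVec
      (continuous_const (y := x)))).tendsto Q).comp hQ
    simpa [hQ0, Function.comp_def] using h1
  have : ‖g x‖ / C ≤ 0 := ge_of_tendsto hlim0 (by
    filter_upwards [eventually_gt_atTop 0] with N hN using hlow' N hN)
  exact absurd this (not_le.2 (div_pos (norm_pos_iff.2 hgx) hC0))

end Perron

/-! ### Necessity: an invariant proper cone yields dominant indices -/

section Necessity

variable {m n q : ℕ} {S : Matrix (Fin m) (Fin m) ℂ} {β : Fin m → Fin q}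
  {A : Fin n → Matrix (Fin m) (Fin m) ℝ} {lam : Fin q → Fin n → ℂ} {b : Fin q → ℂ}

theorem IsDominantIndex.unique (hb : Function.Injective b) {e : Fin n → ℕ} {p p' : Fin q}
    (h : IsDominantIndex lam b e p) (h' : IsDominantIndex lam b e p') : p = p' :=
  hb (h.2.symm.trans h'.2)

theorem norm_prodEig_le (lam : Fin q → Fin n → ℂ) (e : Fin n → ℕ) (i : Fin q) :
    ‖prodEig lam e i‖ ≤ ⨆ i, ‖prodEig lam e i‖ :=
  le_ciSup (f := fun i => ‖prodEig lam e i‖) (Set.finite_range _).bddAbove i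

theorem exists_toC_eq_blockConj_prodEig (hS : IsUnit S)
    (hA : ∀ j, toC (A j) = blockConj S β (fun i => lam i j)) (e : Fin n → ℕ) :
    ∃ M : Matrix (Fin m) (Fin m) ℝ, toC M = blockConj S β (prodEig lam e) ∧
      ∀ K, IsInvariant A K → Preserves M K := by
  suffices H : ∀ s : Finset (Fin n), ∃ M : Matrix (Fin m) (Fin m) ℝ,
      toC M = blockConj S β (fun i => ∏ j ∈ s, lam i j ^ e j) ∧
        ∀ K, IsInvariant A K → Preserves M K from H Finset.univ
  intro s
  induction s using Finset.induction_on with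
  | empty =>
    refine ⟨1, ?_, fun K _ => preserves_one⟩
    rw [toC_eq_mapMatrix, map_one, ← blockHom_apply hS, ← map_one (blockHom hS β)]
    rfl
  | insert j s hj ih =>
    obtain ⟨M, hM, hMK⟩ := ih
    refine ⟨A j ^ e j * M, ?_, fun K hK => (Preserves.pow (hK j) _).mul (hMK K hK)⟩
    rw [toC_eq_mapMatrix, map_mul, map_pow, ← toC_eq_mapMatrix, ← toC_eq_mapMatrix, hM, hA,
      ← blockHom_apply hS, ← blockHom_apply hS, ← blockHom_apply hS, ← map_pow, ← map_mul]
    congr 1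
    funext i
    simp [Finset.prod_insert hj]

theorem preserves_of_mem_matrixCone {K : Set (Fin m → ℝ)} (hK : IsProperCone K)
    (hAK : IsInvariant A K) {B : Matrix (Fin m) (Fin m) ℝ} (hB : B ∈ matrixCone A) :
    Preserves B K := by
  obtain ⟨a, ha, rfl⟩ := hB
  exact Preserves.sum hK.toIsConvexCone hK.zero_mem _ fun j _ =>
    Preserves.smul hK.toIsConvexCone (hAK j) (ha j)

/-- Two successive Perron projections isolate one block, and a nonzero cone vector `y` in its image
satisfies `A j *ᵥ y = lam p j • y`. Reality of `y` makes the eigenvalue real; a negative one would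
put `-y` in `K`. -/
theorem exists_isDominantIndex_of_isProperCone (hm : 0 < m) (hS : IsUnit S)
    (hβ : Function.Surjective β) (hb : Function.Injective b)
    (hA : ∀ j, toC (A j) = blockConj S β (fun i => lam i j))
    {B₀ : Matrix (Fin m) (Fin m) ℝ} (hB₀ : B₀ ∈ matrixCone A) (hB₀S : toC B₀ = blockConj S β b)
    {K : Set (Fin m → ℝ)} (hK : IsProperCone K) (hAK : IsInvariant A K) (e : Fin n → ℕ) :
    ∃ p, IsDominantIndex lam b e p ∧ ∀ j, 0 ≤ lam p j := by
  classical
  have : Nonempty (Fin q) := ⟨β ⟨0, hm⟩⟩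
  obtain ⟨M, hM, hMK⟩ := exists_toC_eq_blockConj_prodEig hS hA e
  obtain ⟨⟨i₀, -, hi₀⟩, R, hR, hRK⟩ := exists_preserves_projection hK hS hβ (I := Set.univ) (R := 1)
    (by
      rw [toC_eq_mapMatrix, map_one, ← blockHom_apply hS, ← map_one (blockHom hS β)]
      simp only [Set.mem_univ, if_true]
      rfl) preserves_one hM (hMK K hAK) (fun i _ => norm_prodEig_le lam e i)
    ((exists_eq_ciSup_of_finite (f := fun i => ‖prodEig lam e i‖)).imp fun i h => ⟨trivial, h⟩)
  have : Nonempty (Omega lam e) := ⟨⟨i₀, hi₀.symm⟩⟩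
  -- The second application concerns `B₀` on the blocks in `Ω(e)`, with the projection `R` from the
  -- first one as input.
  obtain ⟨⟨p, hpΩ, hp⟩, Q, hQ, hQK⟩ := exists_preserves_projection hK hS hβ (I := Omega lam e)
    (R := R) (by
      rw [hR]
      congr 1
      funext i
      simp [Omega, eq_comm]) hRK hB₀S (preserves_of_mem_matrixCone hK hAK hB₀)
    (ρ := ⨆ i₀ : Omega lam e, ‖b i₀‖)
    (fun i hi => le_ciSup (f := fun i : Omega lam e => ‖b i‖) (Set.finite_range _).bddAbove ⟨i, hi⟩)
    (by
      obtain ⟨⟨i, hi⟩, h⟩ := exists_eq_ciSup_of_finite (f := fun i : Omega lam e => ‖b i‖)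
      exact ⟨i, hi, h⟩)
  refine ⟨p, ⟨hpΩ, hp.symm⟩, fun j => ?_⟩
  have hQp : toC Q = blockConj S β (Pi.single p 1) := by
    rw [hQ]
    congr 1
    funext i
    rw [Pi.single_apply, ← hp]
    by_cases hi : i = p
    · subst hi; simp [hpΩ]
    · simp [hi, hb.ne hi]
  have hQ0 : Matrix.mulVecLin Q ≠ 0 := by
    intro h
    have h0 : Q = 0 := Matrix.toLin'.injective (h.trans (map_zero _).symm)
    rw [h0, toC_eq_mapMatrix, map_zero, ← map_zero (blockHom hS β), blockHom_apply] at hQp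
    simpa using congrFun (blockConj_injective hS hβ hQp) p
  obtain ⟨x, hx, hQx⟩ := hK.exists_linearMap_ne_zero _ hQ0
  rw [Matrix.mulVecLin_apply] at hQx
  set y := Q *ᵥ x with hy
  have hyK : y ∈ K := hQK x hx
  have hAy : (fun r => ((A j *ᵥ y) r : ℂ)) = lam p j • fun r => (y r : ℂ) := by
    rw [hy, ← toC_mulVec, ← toC_mulVec, Matrix.mulVec_mulVec, hQp, hA, ← blockHom_apply hS,
      ← blockHom_apply hS, ← map_mul, ← Matrix.smul_mulVec, ← map_smul]
    congr 2
    funext i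
    by_cases hi : i = p
    · subst hi; simp
    · simp [hi]
  obtain ⟨r, hr⟩ := Function.ne_iff.1 hQx
  have hr' : y r ≠ 0 := hr
  have hreal : lam p j = (((A j *ᵥ y) r / y r : ℝ) : ℂ) := by
    have := congrFun hAy r
    rw [Complex.ofReal_div, this, Pi.smul_apply, smul_eq_mul,
      mul_div_cancel_right₀ _ (Complex.ofReal_ne_zero.2 hr')]
  set a : ℝ := (A j *ᵥ y) r / y r
  have hAy' : A j *ᵥ y = a • y := by
    ext s
    have := congrFun hAy s
    rw [hreal, Pi.smul_apply, smul_eq_mul] at this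
    exact_mod_cast this
  rw [hreal, Complex.zero_le_real]
  by_contra! hneg
  have h1 : a • y ∈ K := hAy' ▸ hAK j y hyK
  have h2 : -y ∈ K := by
    have := hK.smul_mem (-a)⁻¹ (inv_nonneg.2 (neg_nonneg.2 hneg.le)) _ h1
    rwa [smul_smul, inv_neg, neg_mul, inv_mul_cancel₀ hneg.ne, neg_one_smul] at this
  exact hQx (hK.eq_zero_of_neg_mem hyK h2)

end Necessity

/-! ### Closures, generated invariant cones and the dominated cone -/

section ConvexCones

variable {m n q : ℕ} {K : Set (Fin m → ℝ)}

theorem IsConvexCone.closure (hK : IsConvexCone K) : IsConvexCone (closure K) where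
  smul_mem a ha _ hx :=
    map_mem_closure (continuous_const_smul a) hx fun y hy => hK.smul_mem a ha y hy
  add_mem _ hx _ hy := map_mem_closure₂ continuous_add hx hy fun a ha c hc => hK.add_mem a ha c hc

theorem IsInvariant.closure {A : Fin n → Matrix (Fin m) (Fin m) ℝ} (hK : IsInvariant A K) :
    IsInvariant A (closure K) := fun j _ hx =>
  map_mem_closure (continuous_const.matrix_mulVec continuous_id) hx fun y hy => hK j y hy

theorem IsConvexCone.interior_nonempty (hK : IsConvexCone K) (hne : K.Nonempty)
    (hspan : Submodule.span ℝ K = ⊤) : (interior K).Nonempty := by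
  rw [hK.convex.interior_nonempty_iff_affineSpan_eq_top,
    AffineSubspace.affineSpan_eq_top_iff_vectorSpan_eq_top_of_nonempty ℝ _ _ hne, eq_top_iff,
    ← hspan, Submodule.span_le]
  have h0 : (0 : Fin m → ℝ) ∈ K := by
    obtain ⟨x, hx⟩ := hne
    simpa using hK.smul_mem 0 le_rfl x hx
  intro x hx
  simpa using vsub_mem_vectorSpan ℝ hx h0

theorem subset_smallestInvariantCone (A : Fin n → Matrix (Fin m) (Fin m) ℝ)
    (X : Set (Fin m → ℝ)) : X ⊆ smallestInvariantCone A X := fun _ hx _ hC => hC.1 hx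

theorem isConvexCone_smallestInvariantCone (A : Fin n → Matrix (Fin m) (Fin m) ℝ)
    (X : Set (Fin m → ℝ)) : IsConvexCone (smallestInvariantCone A X) where
  smul_mem a ha x hx C hC := hC.2.1.smul_mem a ha x (hx C hC)
  add_mem x hx y hy C hC := hC.2.1.add_mem x (hx C hC) y (hy C hC)

theorem isInvariant_smallestInvariantCone (A : Fin n → Matrix (Fin m) (Fin m) ℝ)
    (X : Set (Fin m → ℝ)) : IsInvariant A (smallestInvariantCone A X) :=
  fun j x hx C hC => hC.2.2 j x (hx C hC)

/-- The vectors whose coordinates in the first part of a basis are nonnegative and have a sum that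
dominates the absolute values of the other coordinates. -/
def dominatedCone {ι κ : Type*} [Fintype ι] (B : Module.Basis (ι ⊕ κ) ℝ (Fin m → ℝ)) :
    Set (Fin m → ℝ) :=
  {x | (∀ l, 0 ≤ B.coord (Sum.inl l) x) ∧
    ∀ t, |B.coord (Sum.inr t) x| ≤ ∑ l, B.coord (Sum.inl l) x}

section DominatedCone

variable {ι κ : Type*} [Fintype ι] (B : Module.Basis (ι ⊕ κ) ℝ (Fin m → ℝ))

theorem isConvexCone_dominatedCone : IsConvexCone (dominatedCone B) where
  smul_mem a ha x hx := by
    refine ⟨fun l => ?_, fun t => ?_⟩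
    · rw [map_smul]
      exact mul_nonneg ha (hx.1 l)
    · simp only [map_smul, smul_eq_mul, ← Finset.mul_sum, abs_mul, abs_of_nonneg ha]
      exact mul_le_mul_of_nonneg_left (hx.2 t) ha
  add_mem x hx y hy := by
    refine ⟨fun l => ?_, fun t => ?_⟩
    · rw [map_add]
      exact add_nonneg (hx.1 l) (hy.1 l)
    · simp only [map_add, Finset.sum_add_distrib]
      exact (abs_add_le _ _).trans (add_le_add (hx.2 t) (hy.2 t))

theorem isClosed_dominatedCone : IsClosed (dominatedCone B) := by
  have hc : ∀ s, Continuous (B.coord s) := fun s => LinearMap.continuous_of_finiteDimensional _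
  refine IsClosed.inter (s₁ := {x | ∀ l, 0 ≤ B.coord (Sum.inl l) x})
    (s₂ := {x | ∀ t, |B.coord (Sum.inr t) x| ≤ ∑ l, B.coord (Sum.inl l) x}) ?_ ?_
  · simp only [Set.ofPred_forall]
    exact isClosed_iInter fun l => isClosed_le continuous_const (hc _)
  · simp only [Set.ofPred_forall]
    exact isClosed_iInter fun t =>
      isClosed_le (hc _).abs (continuous_finsetSum _ fun l _ => hc _)

variable {B}

theorem eq_zero_of_mem_dominatedCone {x : Fin m → ℝ} (hx : x ∈ dominatedCone B)
    (hx' : -x ∈ dominatedCone B) : x = 0 := by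
  have h1 : ∀ l, B.coord (Sum.inl l) x = 0 := fun l =>
    le_antisymm (by simpa using hx'.1 l) (hx.1 l)
  refine B.ext_elem fun s => ?_
  rcases s with l | t
  · simpa using h1 l
  · have h2 := hx.2 t
    simp only [h1, Finset.sum_const_zero, abs_nonpos_iff] at h2
    simpa using h2

theorem mem_dominatedCone [Fintype κ] {a : ι → ℝ} {z : κ → ℝ} (ha : ∀ l, 0 ≤ a l)
    (hz : ∀ t, |z t| ≤ ∑ l, a l) :
    ∑ l, a l • B (Sum.inl l) + ∑ t, z t • B (Sum.inr t) ∈ dominatedCone B := by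
  have h : ∀ s, B.coord s (∑ l, a l • B (Sum.inl l) + ∑ t, z t • B (Sum.inr t)) = Sum.elim a z s := by
    intro s
    have := B.repr_sum_self (Sum.elim a z)
    rw [Fintype.sum_sum_type] at this
    exact congrFun this s
  refine ⟨fun l => ?_, fun t => ?_⟩
  · rw [h]; exact ha l
  · simp only [h]; exact hz t

end DominatedCone

end ConvexCones

/-! ### Sufficiency: trapping `K₀` in the dominated cone -/

section Sufficiency

variable {m n q : ℕ} {S : Matrix (Fin m) (Fin m) ℂ} {β : Fin m → Fin q}
  {A : Fin n → Matrix (Fin m) (Fin m) ℝ} {lam : Fin q → Fin n → ℂ} {b : Fin q → ℂ}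

theorem IsDominantIndex.im_eq_zero {e : Fin n → ℕ} {p : Fin q} (h : IsDominantIndex lam b e p) :
    (b p).im = 0 := by
  rw [← h.2]
  exact Complex.ofReal_im _

theorem exists_prod_eq_blockConj_prodEig (hS : IsUnit S)
    (hA : ∀ j, toC (A j) = blockConj S β (fun i => lam i j)) (w : List (Fin n)) :
    ∃ e, toC (w.map A).prod = blockConj S β (prodEig lam e) := by
  induction w with
  | nil =>
    refine ⟨0, ?_⟩
    rw [List.map_nil, List.prod_nil, toC_eq_mapMatrix, map_one, ← blockHom_apply hS,
      ← map_one (blockHom hS β)]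
    congr 1
    funext i
    simp [prodEig]
  | cons j w ih =>
    obtain ⟨e, he⟩ := ih
    refine ⟨Pi.single j 1 + e, ?_⟩
    rw [List.map_cons, List.prod_cons, toC_eq_mapMatrix, map_mul, ← toC_eq_mapMatrix,
      ← toC_eq_mapMatrix, he, hA, ← blockHom_apply hS, ← blockHom_apply hS, ← blockHom_apply hS,
      ← map_mul]
    congr 1
    funext i
    have h1 : ∏ k, lam i k ^ (Pi.single j 1 : Fin n → ℕ) k = lam i j := by
      rw [Finset.prod_eq_single j]
      · simp
      · intro k _ hk
        simp [hk]
      · simp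
    simp [prodEig, pow_add, Finset.prod_mul_distrib, h1]

/-- Otherwise the coordinate along a column of block `p` would vanish on the whole basis: vectors of
`F₋` lie in blocks outside `P`, and pairs in `F_c` involve only a non-real block and its conjugate.
-/
theorem IsAdaptedBasis.exists_plus_mem {P : Set (Fin q)} {mp mm mc : ℕ} {Fp : Fin mp → Fin m → ℝ}
    {Fm : Fin mm → Fin m → ℝ} {u v : Fin mc → Fin m → ℝ}
    (h : IsAdaptedBasis S β b P Fp Fm u v) (hS : IsUnit S) (hβ : Function.Surjective β)
    {B₀ : Matrix (Fin m) (Fin m) ℝ} (hB₀S : toC B₀ = blockConj S β b) {p : Fin q} (hp : p ∈ P)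
    (hbp : (b p).im = 0) : ∃ l, (fun r => (Fp l r : ℂ)) ∈ blockSpan S β p := by
  by_contra! hno
  obtain ⟨c, rfl⟩ := hβ p
  have hne : ∀ i, (b i).im ≠ 0 → β c ≠ i := by
    rintro i hi rfl
    exact hi hbp
  have hcplx : ∀ t, realCoord S c (u t) = 0 ∧ realCoord S c (v t) = 0 := by
    intro t
    obtain ⟨i, hi, hx⟩ := h.mem_cplx t
    have h1 := (mem_blockSpan_iff hS β i _).1 hx c (hne i hi)
    have h2 := coord_star_eq_zero hS hB₀S hx (c := c) (by
      intro h
      rw [h] at hbp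
      simp [hi] at hbp)
    have e1 : (fun r => (u t r : ℂ) + Complex.I * (v t r : ℂ)) =
      (fun r => (u t r : ℂ)) + Complex.I • fun r => (v t r : ℂ) := rfl
    have e2 : star (fun r => (u t r : ℂ) + Complex.I * (v t r : ℂ)) =
        (fun r => (u t r : ℂ)) - Complex.I • fun r => (v t r : ℂ) := by
      ext r
      simp [sub_eq_add_neg]
    rw [e1, map_add, map_smul, smul_eq_mul] at h1
    rw [e2, map_sub, map_smul, smul_eq_mul] at h2
    rw [realCoord_apply, realCoord_apply]
    refine ⟨by linear_combination (h1 + h2) / 2, ?_⟩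
    have : Complex.I * coord S c (fun r => (v t r : ℂ)) = 0 := by
      linear_combination (h1 - h2) / 2
    exact (mul_eq_zero.1 this).resolve_left Complex.I_ne_zero
  refine realCoord_ne_zero hS c (LinearMap.ext_on h.span_eq_top ?_)
  rintro _ ⟨l | t | t | t, rfl⟩
  · obtain ⟨i, -, hi⟩ := h.mem_plus l
    refine (mem_blockSpan_iff hS β i _).1 hi c ?_
    rintro rfl
    exact hno l hi
  · obtain ⟨i, hiP, -, hi⟩ := h.mem_minus t
    refine (mem_blockSpan_iff hS β i _).1 hi c ?_
    rintro rfl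
    exact hiP hp
  · exact (hcplx t).1
  · exact (hcplx t).2

theorem IsAdaptedBasis.span_generators {P : Set (Fin q)} {mp mm mc : ℕ} {Fp : Fin mp → Fin m → ℝ}
    {Fm : Fin mm → Fin m → ℝ} {u v : Fin mc → Fin m → ℝ}
    (h : IsAdaptedBasis S β b P Fp Fm u v) : Submodule.span ℝ (generators Fp Fm u v) = ⊤ := by
  rw [eq_top_iff, ← h.span_eq_top, Submodule.span_le]
  have hFp : ∀ l, Fp l ∈ Submodule.span ℝ (generators Fp Fm u v) := fun l =>
    Submodule.subset_span (Or.inl (Or.inl ⟨l, rfl⟩))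
  have hf : ∑ l, Fp l ∈ Submodule.span ℝ (generators Fp Fm u v) :=
    Submodule.sum_mem _ fun l _ => hFp l
  rintro _ ⟨l | t | t | t, rfl⟩
  · exact hFp l
  · exact (Submodule.add_mem_iff_right _ hf).1 (Submodule.subset_span (Or.inl (Or.inr ⟨t, rfl⟩)))
  · exact (Submodule.add_mem_iff_right _ hf).1 (Submodule.subset_span (Or.inr (Or.inl ⟨t, rfl⟩)))
  · exact (Submodule.add_mem_iff_right _ hf).1 (Submodule.subset_span (Or.inr (Or.inr ⟨t, rfl⟩)))

/-- The basis of `ℝ^m` that an adapted basis consists of. -/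
noncomputable def IsAdaptedBasis.basis {P : Set (Fin q)} {mp mm mc : ℕ}
    {Fp : Fin mp → Fin m → ℝ} {Fm : Fin mm → Fin m → ℝ} {u v : Fin mc → Fin m → ℝ}
    (h : IsAdaptedBasis S β b P Fp Fm u v) :
    Module.Basis (Fin mp ⊕ Fin mm ⊕ Fin mc ⊕ Fin mc) ℝ (Fin m → ℝ) :=
  Module.Basis.mk h.linearIndependent h.span_eq_top.ge

/-- The image of `f` has nonnegative `F₊`-coordinates whose sum is at least every `‖μ i‖`. The added
vector contributes coordinates that are, up to sign, real or imaginary parts of a single `μ i`,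
hence are dominated. -/
theorem IsAdaptedBasis.prod_mulVec_mem (hS : IsUnit S) (hβ : Function.Surjective β)
    (hA : ∀ j, toC (A j) = blockConj S β (fun i => lam i j))
    {B₀ : Matrix (Fin m) (Fin m) ℝ} (hB₀S : toC B₀ = blockConj S β b)
    (hdom : ∀ e : Fin n → ℕ, ∃ p, IsDominantIndex lam b e p)
    (hnn : ∀ i ∈ dominantSet lam b, ∀ j, 0 ≤ lam i j)
    {mp mm mc : ℕ} {Fp : Fin mp → Fin m → ℝ}
    {Fm : Fin mm → Fin m → ℝ} {u v : Fin mc → Fin m → ℝ}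
    (h : IsAdaptedBasis S β b (dominantSet lam b) Fp Fm u v) (w : List (Fin n))
    {x : Fin m → ℝ} (hx : x ∈ generators Fp Fm u v) :
    (w.map A).prod *ᵥ x ∈ dominatedCone h.basis := by
  obtain ⟨e, hM⟩ := exists_prod_eq_blockConj_prodEig hS hA w
  set M := (w.map A).prod
  set μ := prodEig lam e
  have hBp : ∀ l, h.basis (Sum.inl l) = Fp l := fun l => by simp [IsAdaptedBasis.basis]
  have hBm : ∀ t, h.basis (Sum.inr (Sum.inl t)) = Fm t := fun t => by simp [IsAdaptedBasis.basis]
  have hBu : ∀ t, h.basis (Sum.inr (Sum.inr (Sum.inl t))) = u t := fun t => by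
    simp [IsAdaptedBasis.basis]
  have hBv : ∀ t, h.basis (Sum.inr (Sum.inr (Sum.inr t))) = v t := fun t => by
    simp [IsAdaptedBasis.basis]
  choose k hkP hk using h.mem_plus
  have hMp : ∀ l, M *ᵥ Fp l = (μ (k l)).re • Fp l := fun l =>
    mulVec_eq_of_ofReal_mem_blockSpan hS hM (hk l)
  have hnn' : ∀ i ∈ dominantSet lam b, 0 ≤ μ i := fun i hi =>
    Finset.prod_nonneg fun j _ => pow_nonneg (hnn i hi j) _
  have ha : ∀ l, 0 ≤ (μ (k l)).re := fun l => (Complex.le_def.1 (hnn' _ (hkP l))).1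
  have hle : ∀ i, ‖μ i‖ ≤ ∑ l, (μ (k l)).re := by
    obtain ⟨p, hp⟩ := hdom e
    have hpP : p ∈ dominantSet lam b := ⟨e, hp⟩
    obtain ⟨l, hl⟩ := h.exists_plus_mem hS hβ hB₀S hpP hp.im_eq_zero
    -- A nonzero vector cannot lie in two different blocks.
    have hpl : k l = p := by
      by_contra hne
      have h0 : Fp l = 0 := by
        have : (fun r => (Fp l r : ℂ)) = 0 := by
          refine eq_zero_of_coord_eq_zero hS fun c => ?_
          by_cases hc : β c = p
          · exact (mem_blockSpan_iff hS β _ _).1 (hk l) c (fun h => hne (h.symm.trans hc))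
          · exact (mem_blockSpan_iff hS β _ _).1 hl c hc
        funext r
        simpa using congrFun this r
      exact h.basis.ne_zero (Sum.inl l) ((hBp l).trans h0)
    intro i
    have h1 : μ p = ((⨆ i, ‖μ i‖ : ℝ) : ℂ) := hp.1.symm
    calc ‖μ i‖ ≤ ⨆ i, ‖μ i‖ := norm_prodEig_le lam e i
      _ = (μ (k l)).re := by rw [hpl, h1, Complex.ofReal_re]
      _ ≤ _ := Finset.single_le_sum (f := fun l => (μ (k l)).re) (fun l _ => ha l)
          (Finset.mem_univ l)
  have h0 : 0 ≤ ∑ l, (μ (k l)).re := Finset.sum_nonneg fun l _ => ha l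
  have hMf : M *ᵥ (∑ l, Fp l) = ∑ l, (μ (k l)).re • h.basis (Sum.inl l) := by
    simp only [Matrix.mulVec_sum, hMp, hBp]
  have hz : ∀ {t t'} {r r' : ℝ}, t ≠ t' → |r| ≤ ∑ l, (μ (k l)).re → |r'| ≤ ∑ l, (μ (k l)).re →
      M *ᵥ (∑ l, Fp l) + (r • h.basis (Sum.inr t) + r' • h.basis (Sum.inr t')) ∈
        dominatedCone h.basis := by
    intro t t' r r' htt hr hr'
    have := mem_dominatedCone (B := h.basis) (z := Pi.single t r + Pi.single t' r') ha (by
      intro s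
      by_cases hs : s = t
      · subst hs
        simpa [htt] using hr
      · by_cases hs' : s = t'
        · subst hs'
          simpa [hs] using hr'
        · simpa [hs, hs'] using h0)
    rw [hMf]
    convert this using 2
    simp [add_smul, Finset.sum_add_distrib, Pi.single_apply, ite_smul]
  rcases hx with (⟨l, rfl⟩ | ⟨t, rfl⟩) | (⟨t, rfl⟩ | ⟨t, rfl⟩)
  · have := mem_dominatedCone (B := h.basis) (a := Pi.single l (μ (k l)).re) (z := 0)
      (fun l' => by
        by_cases hl : l' = l
        · subst hl; simpa using ha l'
        · simp [hl])
      (fun t => by simpa using ha l)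
    rw [hMp]
    simpa [Pi.single_apply, ite_smul, hBp] using this
  · obtain ⟨i, -, -, hi⟩ := h.mem_minus t
    have := mem_dominatedCone (B := h.basis) (z := Pi.single (Sum.inl t) (μ i).re) ha (by
      intro s
      by_cases hs : s = Sum.inl t
      · subst hs
        simpa using (Complex.abs_re_le_norm _).trans (hle i)
      · simpa [hs] using h0)
    simp only [Matrix.mulVec_add, hMf, mulVec_eq_of_ofReal_mem_blockSpan hS hM hi]
    convert this using 2
    simp [Pi.single_apply, ite_smul, hBm]
  · obtain ⟨i, -, hi⟩ := h.mem_cplx t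
    have := hz (t := Sum.inr (Sum.inl t)) (t' := Sum.inr (Sum.inr t)) (by simp)
      ((Complex.abs_re_le_norm (μ i)).trans (hle i))
      (r' := -(μ i).im) (by rw [abs_neg]; exact (Complex.abs_im_le_norm (μ i)).trans (hle i))
    rw [hBu, hBv, neg_smul, ← sub_eq_add_neg] at this
    simpa only [Matrix.mulVec_add, (mulVec_eq_of_mem_blockSpan hS hM hi).1] using this
  · obtain ⟨i, -, hi⟩ := h.mem_cplx t
    have := hz (t := Sum.inr (Sum.inl t)) (t' := Sum.inr (Sum.inr t)) (by simp)
      ((Complex.abs_im_le_norm (μ i)).trans (hle i))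
      ((Complex.abs_re_le_norm (μ i)).trans (hle i))
    rw [hBu, hBv] at this
    simpa only [Matrix.mulVec_add, (mulVec_eq_of_mem_blockSpan hS hM hi).2] using this

theorem IsAdaptedBasis.isProperCone_closure (hm : 0 < m) (hS : IsUnit S)
    (hβ : Function.Surjective β)
    (hA : ∀ j, toC (A j) = blockConj S β (fun i => lam i j))
    {B₀ : Matrix (Fin m) (Fin m) ℝ} (hB₀S : toC B₀ = blockConj S β b)
    (hdom : ∀ e : Fin n → ℕ, ∃ p, IsDominantIndex lam b e p)
    (hnn : ∀ i ∈ dominantSet lam b, ∀ j, 0 ≤ lam i j)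
    {mp mm mc : ℕ} {Fp : Fin mp → Fin m → ℝ}
    {Fm : Fin mm → Fin m → ℝ} {u v : Fin mc → Fin m → ℝ}
    (h : IsAdaptedBasis S β b (dominantSet lam b) Fp Fm u v) :
    Submodule.span ℝ (smallestInvariantCone A (generators Fp Fm u v)) = ⊤ ∧
      IsProperCone (closure (smallestInvariantCone A (generators Fp Fm u v))) := by
  have : Nonempty (Fin m) := ⟨⟨0, hm⟩⟩
  set K₀ := smallestInvariantCone A (generators Fp Fm u v) with hK₀
  have hcone : IsConvexCone K₀ := isConvexCone_smallestInvariantCone A _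
  have hspan : Submodule.span ℝ K₀ = ⊤ := by
    rw [eq_top_iff, ← h.span_generators]
    exact Submodule.span_mono (subset_smallestInvariantCone A _)
  -- `IsConvexCone` admits the empty set, so nonemptiness has to come from spanning a nonzero space.
  have hne : K₀.Nonempty := by
    by_contra hempty
    rw [Set.not_nonempty_iff_eq_empty.1 hempty, Submodule.span_empty] at hspan
    exact bot_ne_top hspan
  have hsub : closure K₀ ⊆ dominatedCone h.basis := by
    refine closure_minimal ?_ (isClosed_dominatedCone _)
    intro x hx
    have hD := isConvexCone_dominatedCone h.basis
    -- The dominated cone need not be invariant. The set of vectors all of whose images under words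
    -- in the `A j` stay in it is invariant, by appending a letter; the empty word then gives the
    -- inclusion.
    have := hx {x | ∀ w : List (Fin n), (w.map A).prod *ᵥ x ∈ dominatedCone h.basis}
      ⟨fun y hy w => h.prod_mulVec_mem hS hβ hA hB₀S hdom hnn w hy,
        ⟨fun a ha y hy w => by
          rw [Matrix.mulVec_smul]
          exact hD.smul_mem a ha _ (hy w),
        fun y hy z hz w => by
          rw [Matrix.mulVec_add]
          exact hD.add_mem _ (hy w) _ (hz w)⟩,
        fun j y hy w => by
          have := hy (w ++ [j])
          rwa [List.map_append, List.prod_append, List.map_singleton, List.prod_singleton,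
            ← Matrix.mulVec_mulVec] at this⟩
    simpa using this []
  refine ⟨hspan, hcone.closure, isClosed_closure, ?_, ?_⟩
  · ext x
    constructor
    · rintro ⟨hx, hx'⟩
      exact eq_zero_of_mem_dominatedCone (hsub hx) (hsub hx')
    · rintro rfl
      have h0 : (0 : Fin m → ℝ) ∈ closure K₀ := by
        obtain ⟨x, hx⟩ := hne
        simpa using subset_closure (hcone.smul_mem 0 le_rfl x hx)
      exact ⟨h0, by simpa using h0⟩
  · exact (hcone.interior_nonempty hne hspan).mono (interior_mono subset_closure)

end Sufficiency

/-! ### Existence of an adapted basis -/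

section AdaptedBasis

variable {m n q : ℕ} {S : Matrix (Fin m) (Fin m) ℂ} {β : Fin m → Fin q} {b : Fin q → ℂ}

theorem realCoord_re (S : Matrix (Fin m) (Fin m) ℂ) (c : Fin m) (y : Fin m → ℂ) :
    realCoord S c (fun r => (y r).re) = (coord S c y + coord S c (star y)) / 2 := by
  have : (fun r => ((y r).re : ℂ)) = (2⁻¹ : ℂ) • (y + star y) := by
    ext r
    simp [Complex.re_eq_add_conj, div_eq_inv_mul]
  rw [realCoord_apply, this, map_smul, map_add, smul_eq_mul, div_eq_inv_mul]

theorem realCoord_im (S : Matrix (Fin m) (Fin m) ℂ) (c : Fin m) (y : Fin m → ℂ) :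
    realCoord S c (fun r => (y r).im) =
      -Complex.I * ((coord S c y - coord S c (star y)) / 2) := by
  have : (fun r => ((y r).im : ℂ)) = (-Complex.I * 2⁻¹ : ℂ) • (y - star y) := by
    ext r
    rw [Complex.im_eq_sub_conj (y r), div_eq_mul_inv, mul_inv, Complex.inv_I]
    simp
    ring
  rw [realCoord_apply, this, map_smul, map_sub, smul_eq_mul]
  ring

theorem col_mem_blockSpan (S : Matrix (Fin m) (Fin m) ℂ) (β : Fin m → Fin q) (c : Fin m) :
    S.col c ∈ blockSpan S β (β c) :=
  Submodule.subset_span ⟨c, rfl, rfl⟩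

/-- For a real matrix, the coordinates of the real and imaginary parts of the columns that belong to
eigenvalues in the upper half-plane. -/
theorem realCoord_col (hS : IsUnit S) {B : Matrix (Fin m) (Fin m) ℝ}
    (hB : toC B = blockConj S β b) {c d : Fin m} (hc : 0 < (b (β c)).im)
    (hd : 0 < (b (β d)).im) :
    realCoord S c (fun r => (S.col d r).re) = (if c = d then 1 else 0) / 2 ∧
      realCoord S c (fun r => (S.col d r).im) = -Complex.I * ((if c = d then 1 else 0) / 2) := by
  have h0 : coord S c (star (S.col d)) = 0 := by
    refine coord_star_eq_zero hS hB (col_mem_blockSpan S β d) fun h => ?_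
    have := congrArg Complex.im h
    simp only [Complex.star_def, Complex.conj_im] at this
    linarith
  rw [realCoord_re, realCoord_im, coord_col hS, h0, add_zero, sub_zero]
  exact ⟨rfl, rfl⟩

/-- Any subspace of `ℝ^m` that contains the real vectors in the blocks with real eigenvalues and the
real and imaginary parts of the columns for eigenvalues in the upper half-plane is everything. -/
theorem eq_top_of_mem_of_mem (hS : IsUnit S) {B : Matrix (Fin m) (Fin m) ℝ}
    (hb : Function.Injective b) (hB : toC B = blockConj S β b) {W : Submodule ℝ (Fin m → ℝ)}
    (hreal : ∀ i, (b i).im = 0 → ∀ y : Fin m → ℝ,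
      (fun r => (y r : ℂ)) ∈ blockSpan S β i → y ∈ W)
    (hcplx : ∀ c, 0 < (b (β c)).im →
      (fun r => (S.col c r).re) ∈ W ∧ (fun r => (S.col c r).im) ∈ W) : W = ⊤ := by
  have hsum : ∀ y : Fin m → ℂ, (∀ c, (fun r => (coord S c y * S.col c r).re) ∈ W) →
      (fun r => (y r).re) ∈ W := by
    intro y hy
    have : (fun r => (y r).re) = ∑ c, fun r => (coord S c y * S.col c r).re := by
      ext r
      conv_lhs => rw [← sum_coord_smul_col hS y]
      simp [Finset.sum_apply]
    rw [this]
    exact Submodule.sum_mem _ fun c _ => hy c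
  have hupper : ∀ y : Fin m → ℂ, (∀ c, coord S c y ≠ 0 → 0 < (b (β c)).im) →
      (fun r => (y r).re) ∈ W := by
    refine fun y hy => hsum y fun c => ?_
    by_cases hc : coord S c y = 0
    · simp only [hc, zero_mul, Complex.zero_re]
      exact W.zero_mem
    · obtain ⟨hre, him⟩ := hcplx c (hy c hc)
      exact W.sub_mem (W.smul_mem (coord S c y).re hre) (W.smul_mem (coord S c y).im him)
  have hblock : ∀ i, ∀ y ∈ blockSpan S β i, (fun r => (y r).re) ∈ W := by
    intro i y hy
    rcases lt_trichotomy (b i).im 0 with hi | hi | hi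
    · have : (fun r => (y r).re) = fun r => ((star y) r).re := by
        ext r
        simp
      rw [this]
      refine hupper _ fun c hc => ?_
      have h1 : b (β c) = star (b i) := by
        by_contra hne
        exact hc (coord_star_eq_zero hS hB hy hne)
      rw [h1]
      simpa using hi
    · refine hreal i hi _ ((mem_blockSpan_iff hS β i _).2 fun c hc => ?_)
      have h1 : coord S c (star y) = 0 := by
        refine coord_star_eq_zero hS hB hy fun h => hc (hb ?_)
        rw [h]
        exact Complex.conj_eq_iff_im.2 hi
      rw [← realCoord_apply, realCoord_re, h1, (mem_blockSpan_iff hS β i y).1 hy c hc]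
      simp
    · refine hupper y fun c hc => ?_
      have : β c = i := by
        by_contra hne
        exact hc ((mem_blockSpan_iff hS β i y).1 hy c hne)
      rwa [this]
  rw [eq_top_iff]
  intro x _
  have := hsum (fun r => (x r : ℂ)) fun c =>
    hblock _ _ (Submodule.smul_mem _ (coord S c fun r => (x r : ℂ)) (col_mem_blockSpan S β c))
  simpa using this

/-- A maximal independent set of real vectors in the real blocks is split according to membership of
the block in `P`. The real and imaginary parts of the columns in upper half-plane blocks complete
it; the conjugate blocks add nothing new. -/
theorem exists_isAdaptedBasis (hS : IsUnit S) {B : Matrix (Fin m) (Fin m) ℝ}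
    (hb : Function.Injective b) (hB : toC B = blockConj S β b) (P : Set (Fin q)) :
    ∃ (mp mm mc : ℕ) (Fp : Fin mp → Fin m → ℝ) (Fm : Fin mm → Fin m → ℝ)
      (u v : Fin mc → Fin m → ℝ), IsAdaptedBasis S β b P Fp Fm u v := by
  classical
  obtain ⟨T, hT, hTspan, hTli⟩ := exists_linearIndependent ℝ
    {y : Fin m → ℝ | ∃ i, (b i).im = 0 ∧ (fun r => (y r : ℂ)) ∈ blockSpan S β i}
  have : Finite T := hTli.finite
  set Tp : Set T := {y | ∃ i ∈ P, (fun r => (y.1 r : ℂ)) ∈ blockSpan S β i} with hTp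
  obtain ⟨mp, ⟨ep⟩⟩ := Finite.exists_equiv_fin Tp
  obtain ⟨mm, ⟨em⟩⟩ := Finite.exists_equiv_fin ↥Tpᶜ
  obtain ⟨mc, ⟨ec⟩⟩ := Finite.exists_equiv_fin {c | 0 < (b (β c)).im}
  refine ⟨mp, mm, mc, fun l => (ep.symm l).1.1, fun t => (em.symm t).1.1,
    fun t r => (S.col (ec.symm t) r).re, fun t r => (S.col (ec.symm t) r).im, ?_, ?_, ?_, ?_, ?_⟩
  · rw [Fintype.linearIndependent_iff]
    intro g hg
    simp only [Fintype.sum_sum_type, Sum.elim_inl, Sum.elim_inr] at hg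
    have hreal : ∀ (y : T) (c : Fin m), 0 < (b (β c)).im → realCoord S c y.1 = 0 := by
      intro y c hc
      obtain ⟨i, hi, hy⟩ := hT y.2
      refine (mem_blockSpan_iff hS β i _).1 hy c ?_
      rintro rfl
      exact hc.ne' hi
    have hcplx : ∀ t, g (Sum.inr (Sum.inr (Sum.inl t))) = 0 ∧
        g (Sum.inr (Sum.inr (Sum.inr t))) = 0 := by
      intro t
      -- This coordinate kills all terms except the pair at `t`, leaving half of the `u`-coefficient
      -- minus `i` times half of the `v`-coefficient.
      have h1 := congrArg (realCoord S (ec.symm t)) hg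
      have h2 := fun s => realCoord_col hS hB (ec.symm t).2 (ec.symm s).2
      simp only [map_add, map_sum, map_smul, map_zero, hreal _ _ (ec.symm t).2, (h2 _).1, (h2 _).2,
        Subtype.val_inj, ec.symm.injective.eq_iff] at h1
      constructor
      · simpa [apply_ite Complex.re, apply_ite Complex.im, ite_div, mul_ite] using congrArg Complex.re h1
      · simpa [apply_ite Complex.re, apply_ite Complex.im, ite_div, mul_ite] using congrArg Complex.im h1
    have hw : Sum.elim (fun l => (ep.symm l).1.1) (fun t => (em.symm t).1.1) =
        (Subtype.val : T → Fin m → ℝ) ∘ (Equiv.Set.sumCompl Tp) ∘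
          (Equiv.sumCongr ep.symm em.symm) := by
      funext s
      rcases s with l | t <;> simp
    have hli : LinearIndependent ℝ
        (Sum.elim (fun l => (ep.symm l).1.1) (fun t => (em.symm t).1.1)) := by
      rw [hw]
      exact hTli.comp _ ((Equiv.injective _).comp (Equiv.injective _))
    rw [Fintype.linearIndependent_iff] at hli
    have h3 := hli (Sum.elim (fun l => g (Sum.inl l)) (fun t => g (Sum.inr (Sum.inl t)))) (by
      simpa [Fintype.sum_sum_type, hcplx] using hg)
    rintro (l | t | t | t)
    · exact h3 (Sum.inl l)
    · exact h3 (Sum.inr t)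
    · exact (hcplx t).1
    · exact (hcplx t).2
  · refine eq_top_of_mem_of_mem hS hb hB (fun i hi y hy => ?_) fun c hc => ⟨?_, ?_⟩
    · have hy' : y ∈ Submodule.span ℝ T := by
        rw [hTspan]
        exact Submodule.subset_span ⟨i, hi, hy⟩
      refine Submodule.span_mono ?_ hy'
      intro z hz
      by_cases hzp : (⟨z, hz⟩ : T) ∈ Tp
      · exact ⟨Sum.inl (ep ⟨⟨z, hz⟩, hzp⟩), by simp⟩
      · exact ⟨Sum.inr (Sum.inl (em ⟨⟨z, hz⟩, hzp⟩)), by simp⟩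
    · exact Submodule.subset_span ⟨Sum.inr (Sum.inr (Sum.inl (ec ⟨c, hc⟩))), by simp⟩
    · exact Submodule.subset_span ⟨Sum.inr (Sum.inr (Sum.inr (ec ⟨c, hc⟩))), by simp⟩
  · exact fun l => (ep.symm l).2
  · intro t
    obtain ⟨i, hi, hy⟩ := hT (em.symm t).1.2
    exact ⟨i, fun hiP => (em.symm t).2 ⟨i, hiP, hy⟩, hi, hy⟩
  · intro t
    refine ⟨β (ec.symm t), (ec.symm t).2.ne', ?_⟩
    convert col_mem_blockSpan S β (ec.symm t) using 1
    funext r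
    rw [mul_comm]
    exact Complex.re_add_im _

end AdaptedBasis

end InvCone

open InvCone in
theorem mainTheorem1 {m n q : ℕ} (hm : 0 < m)
    (A : Fin n → Matrix (Fin m) (Fin m) ℝ)
    (S : Matrix (Fin m) (Fin m) ℂ) (hS : IsUnit S)
    -- `S` diagonalizes all the matrices `A j`
    (hdiag : ∀ j, ∃ d : Fin m → ℂ, InvCone.toC (A j) = S * Matrix.diagonal d * S⁻¹)
    -- `q` is the maximal number of distinct eigenvalues in `Cone A`, attained at `B₀`
    (hq : ∀ B ∈ InvCone.matrixCone A, InvCone.numEigenvalues B ≤ q)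
    (B₀ : Matrix (Fin m) (Fin m) ℝ) (hB₀ : B₀ ∈ InvCone.matrixCone A)
    (β : Fin m → Fin q) (hβ : Function.Surjective β)
    (b : Fin q → ℂ) (hb : Function.Injective b)
    (hB₀S : InvCone.toC B₀ = InvCone.blockConj S β b) :
    ∃ lam : Fin q → Fin n → ℂ,
      (∀ j, InvCone.toC (A j) = InvCone.blockConj S β (fun i => lam i j)) ∧
      -- the criterion; its first clause says that all the indices `p(e)`, hence `P`, are defined
      ((∃ K : Set (Fin m → ℝ), InvCone.IsProperCone K ∧ InvCone.IsInvariant A K) ↔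
        (∀ e : Fin n → ℕ, ∃! p, InvCone.IsDominantIndex lam b e p) ∧
          ∀ i ∈ InvCone.dominantSet lam b, ∀ j, 0 ≤ lam i j) ∧
      -- the explicit construction of an invariant proper cone
      (((∀ e : Fin n → ℕ, ∃! p, InvCone.IsDominantIndex lam b e p) ∧
          ∀ i ∈ InvCone.dominantSet lam b, ∀ j, 0 ≤ lam i j) →
        (∃ (mp mm mc : ℕ) (Fp : Fin mp → Fin m → ℝ) (Fm : Fin mm → Fin m → ℝ)
          (u v : Fin mc → Fin m → ℝ),
          InvCone.IsAdaptedBasis S β b (InvCone.dominantSet lam b) Fp Fm u v) ∧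
        ∀ (mp mm mc : ℕ) (Fp : Fin mp → Fin m → ℝ) (Fm : Fin mm → Fin m → ℝ)
          (u v : Fin mc → Fin m → ℝ),
          InvCone.IsAdaptedBasis S β b (InvCone.dominantSet lam b) Fp Fm u v →
          let K₀ := InvCone.smallestInvariantCone A (InvCone.generators Fp Fm u v)
          InvCone.IsConvexCone K₀ ∧ InvCone.IsInvariant A K₀ ∧ Submodule.span ℝ K₀ = ⊤ ∧
            InvCone.IsProperCone (closure K₀) ∧ InvCone.IsInvariant A (closure K₀)) := by
  obtain ⟨lam, hA⟩ := exists_block_eigenvalues hS hdiag hq hB₀ hβ hb hB₀S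
  have hconstr : ((∀ e : Fin n → ℕ, ∃! p, IsDominantIndex lam b e p) ∧
      ∀ i ∈ dominantSet lam b, ∀ j, 0 ≤ lam i j) →
      ∀ (mp mm mc : ℕ) (Fp : Fin mp → Fin m → ℝ) (Fm : Fin mm → Fin m → ℝ)
        (u v : Fin mc → Fin m → ℝ), IsAdaptedBasis S β b (dominantSet lam b) Fp Fm u v →
        Submodule.span ℝ (smallestInvariantCone A (generators Fp Fm u v)) = ⊤ ∧
          IsProperCone (closure (smallestInvariantCone A (generators Fp Fm u v))) :=
    fun h _ _ _ _ _ _ _ hF =>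
      hF.isProperCone_closure hm hS hβ hA hB₀S (fun e => (h.1 e).exists) h.2
  have hbasis := exists_isAdaptedBasis hS hb hB₀S (dominantSet lam b)
  refine ⟨lam, hA, ⟨?_, fun h => ?_⟩, fun h => ⟨hbasis, ?_⟩⟩
  · rintro ⟨K, hK, hAK⟩
    have hdom := exists_isDominantIndex_of_isProperCone hm hS hβ hb hA hB₀ hB₀S hK hAK
    refine ⟨fun e => ?_, ?_⟩
    · obtain ⟨p, hp, -⟩ := hdom e
      exact ⟨p, hp, fun p' hp' => hp'.unique hb hp⟩
    · rintro i ⟨e, hi⟩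
      obtain ⟨p, hp, hnn⟩ := hdom e
      rwa [hi.unique hb hp]
  · obtain ⟨mp, mm, mc, Fp, Fm, u, v, hF⟩ := hbasis
    exact ⟨_, (hconstr h mp mm mc Fp Fm u v hF).2, (isInvariant_smallestInvariantCone A _).closure⟩
  · intro mp mm mc Fp Fm u v hF
    obtain ⟨hspan, hproper⟩ := hconstr h mp mm mc Fp Fm u v hF
    exact ⟨isConvexCone_smallestInvariantCone A _, isInvariant_smallestInvariantCone A _, hspan,
      hproper, (isInvariant_smallestInvariantCone A _).closure⟩
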